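/- For a complex manifold $X$ (Hausdorff, finite-dimensional, holomorphic transition maps) put $A=T^{1,0}X\oplus (T^{0,1}X)^*$ and $A^*=T^{0,1}X\oplus (T^{1,0}X)^*$, with their Lie algebroid structures in which the anchors are the projections to $T^{1,0}X$, respectively $T^{0,1}X$, and the sections with constant coefficients in a holomorphic coordinate frame ($\partial_{z_i},d\bar z_j$, respectively $\partial_{\bar z_j},dz_i$) have zero bracket. An extended Poisson structure on $X$ is a smooth section $H=\pi+\theta+\omega$ of $\wedge^2A$ (with $\pi\in\Gamma(\wedge^2T^{1,0}X)$, $\theta\in\Gamma(T^{1,0}X\otimes (T^{0,1}X)^*)$, $\omega\in\Gamma(\wedge^2(T^{0,1}X)^*)$) such that $\bar\partial H+\tfrac12[H,H]=0$, where $\bar\partial$ is the Lie algebroid differential of $A^*$ and $[\cdot,\cdot]$ the Schouten bracket of $A$. Put $H^\vee=-\pi+\theta-\omega$ and let $\theta^\flat:T^{0,1}X\to T^{1,0}X$ be given by $\langle\xi,\theta^\flat v\rangle=\theta(v,\xi)$. A closed complex submanifold $Y\subset X$ is coisotropic for a section $H$ of $\wedge^2A$ if $H(u,v)=0$ for all $y\in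 Y$ and all $u,v\in T^{0,1}_yY\oplus N^{1,0}_yY\subset A^*_y$, where $N^{1,0}_yY$ is the annihilator of $T^{1,0}_yY$ in $(T^{1,0}_yX)^*$. A holomorphic map $f:X_2\to X_1$ between extended Poisson manifolds $(X_i,H_i)$ is an extended Poisson map if its graph $\{(f(x),x): x\in X_2\}$ is a coisotropic submanifold of $X_1\times X_2^\vee$, that is, of $X_1\times X_2$ with the structure $(H_1,H_2^\vee)$. Proposition. Let $(X_1,H_1)$ and $(X_2,H_2)$ be extended Poisson manifolds with $H_i=\pi_i+\theta_i+\omega_i$. A holomorphic map $f:X_2\to X_1$ is an extended Poisson map if and only if $$f_*\pi_2=\pi_1,\qquad f^*\omega_1=\omega_2,\qquad f_*\circ\theta_2^\flat=\theta_1^\flat\circ f_*,$$ that is, for every $x\in X_2$: $f_*(\pi_2|_x)=\pi_1|_{f(x)}$, $f^*(\omega_1|_{f(x)})=\omega_2|_x$, and $f_*\circ\theta_2^\flat|_x=\theta_1^\flat|_{f(x)}\circ f_*$ as maps $T^{0,1}_xX_2\to T^{1,0}_{f(x)}X_1$. Corollary. If $g:X_3\to X_2$ and $f:X_2\to X_1$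 are extended Poisson maps between extended Poisson manifolds, then $f\circ g:X_3\to X_1$ is an extended Poisson map. -/

import Mathlib

open scoped Manifold ContDiff TensorProduct

noncomputable section

namespace ExtPoisson

section LinearAlgebra

variable (V : Type*) [AddCommGroup V] [Module ℂ V]
variable {W : Type*} [AddCommGroup W] [Module ℂ W]

/-- The almost complex structure: multiplication by `i`, on the underlying real vector space. -/
def almostComplex : V →ₗ[ℝ] V := ((Complex.I) • (LinearMap.id : V →ₗ[ℂ] V)).restrictScalars ℝ

/-- The `ℂ`-linear extension of the almost complex structure to the complexification. -/
def almostComplexC : (ℂ ⊗[ℝ] V) →ₗ[ℂ] (ℂ ⊗[ℝ] V) := (almostComplex V).baseChange ℂ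

/-- `V^{1,0}`, the `+i`-eigenspace in the complexification of `V`. -/
def T10 : Submodule ℂ (ℂ ⊗[ℝ] V) := Module.End.eigenspace (almostComplexC V) Complex.I

/-- `V^{0,1}`, the `-i`-eigenspace in the complexification of `V`. -/
def T01 : Submodule ℂ (ℂ ⊗[ℝ] V) := Module.End.eigenspace (almostComplexC V) (-Complex.I)

variable {V}

/-- The complexification of (the real map underlying) a `ℂ`-linear map. -/
def complexify (L : V →ₗ[ℂ] W) : (ℂ ⊗[ℝ] V) →ₗ[ℂ] (ℂ ⊗[ℝ] W) :=
  (L.restrictScalars ℝ).baseChange ℂ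

theorem complexify_almostComplexC (L : V →ₗ[ℂ] W) (x : ℂ ⊗[ℝ] V) :
    almostComplexC W (complexify L x) = complexify L (almostComplexC V x) := by
  induction x using TensorProduct.induction_on with
  | zero => simp
  | tmul c v => simp [complexify, almostComplexC, almostComplex]
  | add x y hx hy => simp [hx, hy]

/-- The map `V^{1,0} → W^{1,0}` induced by a `ℂ`-linear map. -/
def map10 (L : V →ₗ[ℂ] W) : T10 V →ₗ[ℂ] T10 W :=
  (complexify L).restrict (fun x hx => by
    rw [T10, Module.End.mem_eigenspace_iff] at hx ⊢
    rw [complexify_almostComplexC, hx, map_smul])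

/-- The map `V^{0,1} → W^{0,1}` induced by a `ℂ`-linear map. -/
def map01 (L : V →ₗ[ℂ] W) : T01 V →ₗ[ℂ] T01 W :=
  (complexify L).restrict (fun x hx => by
    rw [T01, Module.End.mem_eigenspace_iff] at hx ⊢
    rw [complexify_almostComplexC, hx, map_smul])

variable (V)

/-- The fibre `V^{1,0} ⊕ (V^{0,1})^*` of the bundle `A`. -/
abbrev A : Type _ := T10 V × Module.Dual ℂ (T01 V)

/-- The fibre `V^{0,1} ⊕ (V^{1,0})^*` of the dual bundle `A^*`. -/
abbrev AStar : Type _ := T01 V × Module.Dual ℂ (T10 V)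

/-- The exterior square of the (finite-dimensional) space `A`, as the space of alternating
bilinear forms on its dual `A^*`. -/
abbrev Wedge2A : Type _ := (AStar V) [⋀^Fin 2]→ₗ[ℂ] ℂ

variable {V}

/-- The anchor of `A`: the projection onto the `(1,0)`-vectors. -/
def anchorA (a : A V) : ℂ ⊗[ℝ] V := (a.1 : ℂ ⊗[ℝ] V)

/-- The anchor of `A^*`: the projection onto the `(0,1)`-vectors. -/
def anchorAStar (α : AStar V) : ℂ ⊗[ℝ] V := (α.1 : ℂ ⊗[ℝ] V)

/-- The map `A_V^* → A_W^*`, `(v, ξ) ↦ (p_* v, s^* ξ)`, given by `ℂ`-linear maps `p : V → W`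
and `s : W → V`. -/
def mapAStar (p : V →ₗ[ℂ] W) (s : W →ₗ[ℂ] V) : AStar V →ₗ[ℂ] AStar W :=
  (map01 p).prodMap (map10 s).dualMap

theorem vecCons_update_zero {M : Type*} (a b c : M) : Function.update ![a, c] 0 b = ![b, c] := by
  funext i
  fin_cases i <;> simp

theorem vecCons_update_one {M : Type*} (a b c : M) : Function.update ![a, c] 1 b = ![a, b] := by
  funext i
  fin_cases i <;> simp

/-- The bilinear form `(α, β) ↦ H(α, β)` underlying `H ∈ ∧² A`. -/
def pairing (H : Wedge2A V) : AStar V →ₗ[ℂ] AStar V →ₗ[ℂ] ℂ :=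
  LinearMap.mk₂ ℂ (fun α β => H ![α, β])
    (fun a b c => by
      have h := H.map_update_add ![a, c] 0 a b
      simpa only [vecCons_update_zero] using h)
    (fun r a c => by
      have h := H.map_update_smul ![a, c] 0 r a
      simpa only [vecCons_update_zero] using h)
    (fun a b c => by
      have h := H.map_update_add ![a, b] 1 b c
      simpa only [vecCons_update_one] using h)
    (fun r a c => by
      have h := H.map_update_smul ![a, c] 1 r c
      simpa only [vecCons_update_one] using h)

/-- `H^♯ : A^* → A`, determined by `⟨H^♯ α, β⟩ = H(α, β)` (see `sharp_spec`). -/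
def sharp [FiniteDimensional ℂ V] (H : Wedge2A V) : AStar V →ₗ[ℂ] A V :=
  LinearMap.prod
    ((Module.evalEquiv ℂ (T10 V)).symm.toLinearMap ∘ₗ
      (pairing H).compl₂ (LinearMap.inr ℂ (T01 V) (Module.Dual ℂ (T10 V))))
    ((pairing H).compl₂ (LinearMap.inl ℂ (T01 V) (Module.Dual ℂ (T10 V))))

theorem sharp_spec [FiniteDimensional ℂ V] (H : Wedge2A V) (α β : AStar V) :
    β.2 (sharp H α).1 + (sharp H α).2 β.1 = H ![α, β] := by
  have h1 : β.2 (sharp H α).1 = pairing H α (0, β.2) := by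
    simp [sharp]
  have h2 : (sharp H α).2 β.1 = pairing H α (β.1, 0) := by
    simp [sharp]
  have h3 : H ![α, β] = pairing H α β := rfl
  rw [h1, h2, h3, ← map_add]
  simp

/-- The component `π ∈ ∧² V^{1,0}` of `H`, as an alternating form on `(V^{1,0})^*`. -/
def piPart (H : Wedge2A V) : (Module.Dual ℂ (T10 V)) [⋀^Fin 2]→ₗ[ℂ] ℂ :=
  H.compLinearMap (LinearMap.inr ℂ (T01 V) (Module.Dual ℂ (T10 V)))

/-- The component `ω ∈ ∧² (V^{0,1})^*` of `H`, as an alternating form on `V^{0,1}`. -/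
def omegaPart (H : Wedge2A V) : (T01 V) [⋀^Fin 2]→ₗ[ℂ] ℂ :=
  H.compLinearMap (LinearMap.inl ℂ (T01 V) (Module.Dual ℂ (T10 V)))

/-- `π` as an element of `∧² A`. -/
def piIn (H : Wedge2A V) : Wedge2A V :=
  (piPart H).compLinearMap (LinearMap.snd ℂ (T01 V) (Module.Dual ℂ (T10 V)))

/-- `ω` as an element of `∧² A`. -/
def omegaIn (H : Wedge2A V) : Wedge2A V :=
  (omegaPart H).compLinearMap (LinearMap.fst ℂ (T01 V) (Module.Dual ℂ (T10 V)))

/-- The mixed component `θ ∈ V^{1,0} ⊗ (V^{0,1})^*` of `H = π + θ + ω`, as an element of `∧² A`. -/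
def thetaIn (H : Wedge2A V) : Wedge2A V := H - piIn H - omegaIn H

/-- `θ^♭ : V^{0,1} → V^{1,0}`, the `(1,0)`-component of `v ↦ θ^♯ (v, 0)`;
that is, `⟨ξ, θ^♭ v⟩ = θ(v, ξ)`. -/
def thetaFlat [FiniteDimensional ℂ V] (H : Wedge2A V) : T01 V →ₗ[ℂ] T10 V :=
  LinearMap.fst ℂ (T10 V) (Module.Dual ℂ (T01 V)) ∘ₗ sharp (thetaIn H) ∘ₗ
    LinearMap.inl ℂ (T01 V) (Module.Dual ℂ (T10 V))

/-- `H^∨ = -π + θ - ω`. -/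
def vee (H : Wedge2A V) : Wedge2A V := -piIn H + thetaIn H - omegaIn H

/-- For a complex subspace `S` of `V`, the subspace `S^{0,1} ⊕ N^{1,0}` of `A^*`, where `N^{1,0}`
is the annihilator of `S^{1,0}` in `(V^{1,0})^*`. -/
def conormalK (S : Submodule ℂ V) : Submodule ℂ (AStar V) :=
  (LinearMap.range (map01 S.subtype)).prod (LinearMap.range (map10 S.subtype)).dualAnnihilator

end LinearAlgebra

section Calculus

variable {E : Type*} [NormedAddCommGroup E] [NormedSpace ℂ E]

/-- The `ℂ`-linear extension to complexified tangent vectors of the real differential of `g`. -/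
def derivC (g : E → ℂ) (z : E) : (ℂ ⊗[ℝ] E) →ₗ[ℂ] ℂ :=
  LinearMap.liftBaseChange ℂ (fderiv ℝ g z).toLinearMap

/-- `∂̄h ∈ ∧³ A` for a section `h` of `∧² A` over an open set of `E`, evaluated on three sections
of `A^*` with constant coefficients. This is the Lie algebroid differential of `A^*`; the sections
with constant coefficients commute, so only the anchor terms are present. -/
def dbar (h : E → Wedge2A E) (z : E) (α β γ : AStar E) : ℂ :=
  derivC (fun y => h y ![β, γ]) z (anchorAStar α) +
  derivC (fun y => h y ![γ, α]) z (anchorAStar β) +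
  derivC (fun y => h y ![α, β]) z (anchorAStar γ)

/-- The (Schouten) bracket `[h, k] ∈ ∧³ A` of two sections of `∧² A` over an open set of `E`,
for the Lie algebroid `A` whose constant-coefficient sections commute, evaluated on three
sections of `A^*` with constant coefficients. -/
def schouten [FiniteDimensional ℂ E] (h k : E → Wedge2A E) (z : E) (α β γ : AStar E) : ℂ :=
  (derivC (fun y => k y ![β, γ]) z (anchorA (sharp (h z) α)) +
    derivC (fun y => k y ![γ, α]) z (anchorA (sharp (h z) β)) +
    derivC (fun y => k y ![α, β]) z (anchorA (sharp (h z) γ))) +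
  (derivC (fun y => h y ![β, γ]) z (anchorA (sharp (k z) α)) +
    derivC (fun y => h y ![γ, α]) z (anchorA (sharp (k z) β)) +
    derivC (fun y => h y ![α, β]) z (anchorA (sharp (k z) γ)))

end Calculus

section Manifolds

variable {E : Type*} [NormedAddCommGroup E] [NormedSpace ℂ E]
  {M : Type*} [TopologicalSpace M] (I : ModelWithCorners ℂ E M)
  {X : Type*} [TopologicalSpace X] [ChartedSpace M X]

instance finiteDimensionalTangent [FiniteDimensional ℂ E] (x : X) : FiniteDimensional ℂ (TangentSpace I x) :=
  inferInstanceAs (FiniteDimensional ℂ E)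

variable (X) in
/-- Families of elements of the fibres of `∧² A` over a complex manifold `X`. -/
abbrev Field2 : Type _ := (x : X) → Wedge2A (TangentSpace I x)

variable {I}

/-- The expression of `H` in the chart centred at `x₀`: the pull-back of `H` by the inverse
chart. -/
def chartExpr (H : Field2 I X) (x₀ : X) (z : E) : Wedge2A E :=
  (H ((extChartAt I x₀).symm z)).compLinearMap
    (mapAStar (V := E) (W := TangentSpace I ((extChartAt I x₀).symm z))
      (mfderiv 𝓘(ℂ, E) I (extChartAt I x₀).symm z).toLinearMap
      (mfderiv I 𝓘(ℂ, E) (extChartAt I x₀) ((extChartAt I x₀).symm z)).toLinearMap)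

/-- `H` is an extended Poisson structure on the (boundaryless) complex manifold `X`: it is a smooth
section of `∧² A` with `∂̄H + ½ [H, H] = 0`. -/
structure IsExtendedPoisson [FiniteDimensional ℂ E] (H : Field2 I X) : Prop where
  smooth : ∀ (x₀ : X) (α β : AStar E),
    ContDiffOn ℝ ∞ (fun z => chartExpr H x₀ z ![α, β]) (extChartAt I x₀).target
  maurerCartan : ∀ (x₀ : X), ∀ z ∈ (extChartAt I x₀).target, ∀ α β γ : AStar E,
    dbar (chartExpr H x₀) z α β γ +
      (1 / 2 : ℂ) * schouten (chartExpr H x₀) (chartExpr H x₀) z α β γ = 0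

variable (I) in
/-- A complex submanifold: a closed subset that is locally the zero set of a holomorphic map
to some `ℂ^m` with surjective differential. -/
def IsComplexSubmanifold (Y : Set X) : Prop :=
  IsClosed Y ∧ ∀ y ∈ Y, ∃ U : Set X, IsOpen U ∧ y ∈ U ∧ ∃ (m : ℕ) (F : X → (Fin m → ℂ)),
    ContMDiffOn I 𝓘(ℂ, Fin m → ℂ) ω F U ∧
    (∀ x ∈ U, x ∈ Y ↔ F x = 0) ∧
    ∀ x ∈ U, x ∈ Y → Function.Surjective (mfderiv I 𝓘(ℂ, Fin m → ℂ) F x)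

variable (I) in
/-- The tangent space at `y` of a complex submanifold `Y`: the space of velocities at `y` of
holomorphic discs in `Y`. -/
def tangentAt (Y : Set X) (y : X) : Submodule ℂ (TangentSpace I y) :=
  Submodule.span ℂ {v | ∃ γ : ℂ → X, ContMDiffAt 𝓘(ℂ, ℂ) I ω γ 0 ∧ (∀ᶠ t in nhds 0, γ t ∈ Y) ∧
    (⟨γ 0, mfderiv 𝓘(ℂ, ℂ) I γ 0 (1 : ℂ)⟩ : TangentBundle I X) = ⟨y, v⟩}

/-- Coisotropic submanifolds with respect to `H`: complex submanifolds `Y` such that `H` vanishes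
on `K = T^{0,1}Y ⊕ N^{1,0}Y`. -/
def IsCoisotropic (H : Field2 I X) (Y : Set X) : Prop :=
  IsComplexSubmanifold I Y ∧
    ∀ y ∈ Y, ∀ u ∈ conormalK (tangentAt I Y y), ∀ v ∈ conormalK (tangentAt I Y y), H y ![u, v] = 0

variable {E₁ : Type*} [NormedAddCommGroup E₁] [NormedSpace ℂ E₁]
  {M₁ : Type*} [TopologicalSpace M₁] {I₁ : ModelWithCorners ℂ E₁ M₁}
  {X₁ : Type*} [TopologicalSpace X₁] [ChartedSpace M₁ X₁]
  {E₂ : Type*} [NormedAddCommGroup E₂] [NormedSpace ℂ E₂]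
  {M₂ : Type*} [TopologicalSpace M₂] {I₂ : ModelWithCorners ℂ E₂ M₂}
  {X₂ : Type*} [TopologicalSpace X₂] [ChartedSpace M₂ X₂]

/-- The structure `(H₁, H₂)` on the product `X₁ × X₂`. -/
def prodField (H₁ : Field2 I₁ X₁) (H₂ : Field2 I₂ X₂) : Field2 (I₁.prod I₂) (X₁ × X₂) := fun p =>
  (H₁ p.1).compLinearMap (mapAStar
    (mfderiv (I₁.prod I₂) I₁ Prod.fst p).toLinearMap
    (mfderiv I₁ (I₁.prod I₂) (fun x => (x, p.2)) p.1).toLinearMap) +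
  (H₂ p.2).compLinearMap (mapAStar
    (mfderiv (I₁.prod I₂) I₂ Prod.snd p).toLinearMap
    (mfderiv I₂ (I₁.prod I₂) (fun x => (p.1, x)) p.2).toLinearMap)

/-- A Poisson relation from `(X₂, H₂)` to `(X₁, H₁)`: a coisotropic submanifold of
`X₁ × X₂^∨`. -/
def IsPoissonRelation (H₁ : Field2 I₁ X₁) (H₂ : Field2 I₂ X₂) (R : Set (X₁ × X₂)) : Prop :=
  IsCoisotropic (prodField H₁ (fun x => vee (H₂ x))) R

/-- An extended Poisson map `f : (X₂, H₂) → (X₁, H₁)`: a holomorphic map whose graph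
`{(f x, x)}` is a Poisson relation. -/
def IsExtendedPoissonMap (H₁ : Field2 I₁ X₁) (H₂ : Field2 I₂ X₂) (f : X₂ → X₁) : Prop :=
  ContMDiff I₂ I₁ ω f ∧ IsPoissonRelation H₁ H₂ (Set.range fun x => (f x, x))

variable (I₁ I₂) in
/-- `f_* : T^{1,0}_x X₂ → T^{1,0}_{f x} X₁`. -/
def push10 (f : X₂ → X₁) (x : X₂) : T10 (TangentSpace I₂ x) →ₗ[ℂ] T10 (TangentSpace I₁ (f x)) :=
  map10 (mfderiv I₂ I₁ f x).toLinearMap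

variable (I₁ I₂) in
/-- `f_* : T^{0,1}_x X₂ → T^{0,1}_{f x} X₁`. -/
def push01 (f : X₂ → X₁) (x : X₂) : T01 (TangentSpace I₂ x) →ₗ[ℂ] T01 (TangentSpace I₁ (f x)) :=
  map01 (mfderiv I₂ I₁ f x).toLinearMap

end Manifolds

end ExtPoisson

end

/-! The graph of a holomorphic map to a Hausdorff manifold is always a closed complex submanifold,
so only the vanishing of `(H₁, H₂^∨)` on `K` has content, and this is a pointwise condition. At `(f
x, x)` the tangent space of the graph is the graph of `L = df_x` (`tangentAt_graph`), so `K`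
consists of the vectors with `(0,1)`-part `(L v, v)` and covector part `(ξ, -ξ ∘ L)`, where `v` and
`ξ` are arbitrary.

On two such vectors, with parameters `(v, ξ)` and `(w, η)`, the form takes the value `π₁(ξ, η) -
π₂(ξ ∘ L, η ∘ L) + ω₁(L v, L w) - ω₂(v, w)` `+ θ₁(L v, η) - θ₂(v, η ∘ L) - (θ₁(L w, ξ) - θ₂(w, ξ ∘
L))`. The signs in `H^∨`, combined with the sign of the conormal covector, give every component of
`H₂` a minus sign. Setting some of the parameters to zero isolates each component, so the form
vanishes exactly when the three intertwining identities hold (`coisotropic_graph_iff`).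

The corollary follows because these identities compose under the chain rule. -/

namespace ExtPoisson

/-! ### Linear algebra: functoriality, components of `H`, and coisotropic graphs of linear maps. -/

section LinearAlgebra

variable {V W U : Type*} [AddCommGroup V] [Module ℂ V] [AddCommGroup W] [Module ℂ W]
  [AddCommGroup U] [Module ℂ U]

theorem complexify_id : complexify (LinearMap.id : V →ₗ[ℂ] V) = LinearMap.id :=
  LinearMap.baseChange_id

theorem complexify_comp (K : W →ₗ[ℂ] U) (L : V →ₗ[ℂ] W) :
    complexify (K ∘ₗ L) = complexify K ∘ₗ complexify L :=
  LinearMap.baseChange_comp (L.restrictScalars ℝ) (K.restrictScalars ℝ)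

theorem complexify_add (K L : V →ₗ[ℂ] W) :
    complexify (K + L) = complexify K + complexify L :=
  LinearMap.baseChange_add (K.restrictScalars ℝ) (L.restrictScalars ℝ)

theorem complexify_zero : complexify (0 : V →ₗ[ℂ] W) = 0 :=
  LinearMap.baseChange_zero

theorem map10_id : map10 (LinearMap.id : V →ₗ[ℂ] V) = LinearMap.id :=
  LinearMap.ext fun x => Subtype.ext (LinearMap.congr_fun complexify_id (x : ℂ ⊗[ℝ] V))

theorem map01_id : map01 (LinearMap.id : V →ₗ[ℂ] V) = LinearMap.id :=
  LinearMap.ext fun x => Subtype.ext (LinearMap.congr_fun complexify_id (x : ℂ ⊗[ℝ] V))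

theorem map10_comp (K : W →ₗ[ℂ] U) (L : V →ₗ[ℂ] W) : map10 (K ∘ₗ L) = map10 K ∘ₗ map10 L :=
  LinearMap.ext fun x => Subtype.ext (LinearMap.congr_fun (complexify_comp K L) (x : ℂ ⊗[ℝ] V))

theorem map01_comp (K : W →ₗ[ℂ] U) (L : V →ₗ[ℂ] W) : map01 (K ∘ₗ L) = map01 K ∘ₗ map01 L :=
  LinearMap.ext fun x => Subtype.ext (LinearMap.congr_fun (complexify_comp K L) (x : ℂ ⊗[ℝ] V))

theorem map10_add (K L : V →ₗ[ℂ] W) : map10 (K + L) = map10 K + map10 L :=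
  LinearMap.ext fun x => Subtype.ext (LinearMap.congr_fun (complexify_add K L) (x : ℂ ⊗[ℝ] V))

theorem map10_zero : map10 (0 : V →ₗ[ℂ] W) = 0 :=
  LinearMap.ext fun x => Subtype.ext (LinearMap.congr_fun complexify_zero (x : ℂ ⊗[ℝ] V))

/-- With a left inverse `P`, the inclusion of the range factors through `G`. Functoriality of
`map01` and `map10` then allows `G` to replace the inclusion that appears in `conormalK`. -/
theorem comp_range_subtype (G : V →ₗ[ℂ] W) (P : W →ₗ[ℂ] V) (h : P ∘ₗ G = LinearMap.id) :
    G ∘ₗ P ∘ₗ (LinearMap.range G).subtype = (LinearMap.range G).subtype := by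
  ext ⟨_, v, rfl⟩
  have := LinearMap.congr_fun h v
  simp only [LinearMap.comp_apply, LinearMap.id_apply] at this
  simp [this]

theorem range_map01_subtype_range (G : V →ₗ[ℂ] W) (P : W →ₗ[ℂ] V) (h : P ∘ₗ G = LinearMap.id) :
    LinearMap.range (map01 (LinearMap.range G).subtype) = LinearMap.range (map01 G) := by
  apply le_antisymm
  · rw [← comp_range_subtype G P h, map01_comp]
    exact LinearMap.range_comp_le_range _ _
  · conv_lhs => rw [← LinearMap.subtype_comp_codRestrict G _ G.mem_range_self, map01_comp]
    exact LinearMap.range_comp_le_range _ _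

theorem range_map10_subtype_range (G : V →ₗ[ℂ] W) (P : W →ₗ[ℂ] V) (h : P ∘ₗ G = LinearMap.id) :
    LinearMap.range (map10 (LinearMap.range G).subtype) = LinearMap.range (map10 G) := by
  apply le_antisymm
  · rw [← comp_range_subtype G P h, map10_comp]
    exact LinearMap.range_comp_le_range _ _
  · conv_lhs => rw [← LinearMap.subtype_comp_codRestrict G _ G.mem_range_self, map10_comp]
    exact LinearMap.range_comp_le_range _ _

theorem mem_conormalK_range_iff (G : V →ₗ[ℂ] W) (P : W →ₗ[ℂ] V) (h : P ∘ₗ G = LinearMap.id)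
    (u : AStar W) :
    u ∈ conormalK (LinearMap.range G) ↔ (∃ v, map01 G v = u.1) ∧ u.2 ∘ₗ map10 G = 0 := by
  rw [conormalK, range_map01_subtype_range G P h, range_map10_subtype_range G P h,
    Submodule.mem_prod, LinearMap.mem_range, Submodule.mem_dualAnnihilator]
  refine and_congr_right fun _ => ⟨fun hu => LinearMap.ext fun w => hu _ ⟨w, rfl⟩, ?_⟩
  rintro hu _ ⟨w, rfl⟩
  exact LinearMap.congr_fun hu w

theorem compLinearMap_vecCons_pair (H : V [⋀^Fin 2]→ₗ[ℂ] ℂ) (L : W →ₗ[ℂ] V) (a b : W) :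
    H.compLinearMap L ![a, b] = H ![L a, L b] := by
  rw [AlternatingMap.compLinearMap_apply]
  congr 1
  funext i
  fin_cases i <;> rfl

theorem alternating_ext_pair {H K : V [⋀^Fin 2]→ₗ[ℂ] ℂ} (h : ∀ a b, H ![a, b] = K ![a, b]) :
    H = K := by
  ext v
  have hv : v = ![v 0, v 1] := by
    funext i
    fin_cases i <;> rfl
  rw [hv, h]

theorem piPart_apply (H : Wedge2A V) (ξ η : Module.Dual ℂ (T10 V)) :
    piPart H ![ξ, η] = pairing H (0, ξ) (0, η) :=
  compLinearMap_vecCons_pair H _ ξ η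

theorem omegaPart_apply (H : Wedge2A V) (v w : T01 V) :
    omegaPart H ![v, w] = pairing H (v, 0) (w, 0) :=
  compLinearMap_vecCons_pair H _ v w

theorem piIn_apply (H : Wedge2A V) (a b : AStar V) :
    piIn H ![a, b] = pairing H (0, a.2) (0, b.2) :=
  (compLinearMap_vecCons_pair (piPart H) _ a b).trans (piPart_apply H _ _)

theorem omegaIn_apply (H : Wedge2A V) (a b : AStar V) :
    omegaIn H ![a, b] = pairing H (a.1, 0) (b.1, 0) :=
  (compLinearMap_vecCons_pair (omegaPart H) _ a b).trans (omegaPart_apply H _ _)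

theorem pairing_swap (H : Wedge2A V) (a b : AStar V) : pairing H a b = -pairing H b a := by
  have h : pairing H (a + b) (a + b) = 0 :=
    H.map_eq_zero_of_eq _ (i := 0) (j := 1) rfl (by decide)
  have ha : pairing H a a = 0 := H.map_eq_zero_of_eq _ (i := 0) (j := 1) rfl (by decide)
  have hb : pairing H b b = 0 := H.map_eq_zero_of_eq _ (i := 0) (j := 1) rfl (by decide)
  simp only [map_add, LinearMap.add_apply, ha, hb] at h
  linear_combination h

/-- The decomposition `H = π + θ + ω`, evaluated. -/
theorem apply_eq_components (H : Wedge2A V) (a b : AStar V) :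
    H ![a, b] = pairing H (0, a.2) (0, b.2) + pairing H (a.1, 0) (0, b.2)
      - pairing H (b.1, 0) (0, a.2) + pairing H (a.1, 0) (b.1, 0) := by
  have ha : a = (a.1, 0) + (0, a.2) := by simp
  have hb : b = (b.1, 0) + (0, b.2) := by simp
  change pairing H a b = _
  conv_lhs => rw [ha, hb]
  simp only [map_add, LinearMap.add_apply]
  rw [pairing_swap H (0, a.2) (b.1, 0)]
  ring

theorem thetaIn_apply (H : Wedge2A V) (a b : AStar V) :
    thetaIn H ![a, b] = pairing H (a.1, 0) (0, b.2) - pairing H (b.1, 0) (0, a.2) := by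
  simp only [thetaIn, AlternatingMap.sub_apply, piIn_apply, omegaIn_apply, apply_eq_components H]
  ring

theorem vee_apply (H : Wedge2A V) (a b : AStar V) :
    vee H ![a, b] = -pairing H (0, a.2) (0, b.2) + pairing H (a.1, 0) (0, b.2)
      - pairing H (b.1, 0) (0, a.2) - pairing H (a.1, 0) (b.1, 0) := by
  simp only [vee, AlternatingMap.sub_apply, AlternatingMap.add_apply, AlternatingMap.neg_apply,
    piIn_apply, omegaIn_apply, thetaIn_apply]
  ring

theorem dual_thetaFlat [FiniteDimensional ℂ V] (H : Wedge2A V) (v : T01 V)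
    (ξ : Module.Dual ℂ (T10 V)) : ξ (thetaFlat H v) = pairing H (v, 0) (0, ξ) := by
  have h := sharp_spec (thetaIn H) (v, 0) (0, ξ)
  rw [thetaIn_apply] at h
  simpa [thetaFlat, ← Prod.zero_eq_mk] using h

/-- Linear functionals separate the points of `T10 W`, so the equality of maps can be tested on
scalars, where `dual_thetaFlat` turns it into an identity between the mixed components. -/
theorem map_thetaFlat_eq_iff [FiniteDimensional ℂ V] [FiniteDimensional ℂ W] (H : Wedge2A W)
    (K : Wedge2A V) (L : V →ₗ[ℂ] W) :
    map10 L ∘ₗ thetaFlat K = thetaFlat H ∘ₗ map01 L ↔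
      ∀ v ξ, pairing H (map01 L v, 0) (0, ξ) = pairing K (v, 0) (0, ξ ∘ₗ map10 L) := by
  simp only [← dual_thetaFlat]
  constructor
  · intro h v ξ
    exact congrArg ξ (LinearMap.congr_fun h v).symm
  · intro h
    refine LinearMap.ext fun v => ?_
    rw [← sub_eq_zero, ← Module.forall_dual_apply_eq_zero_iff ℂ]
    intro ξ
    rw [map_sub, sub_eq_zero]
    exact (h v ξ).symm

/-- The graph `G = i₁ L + i₂` of `L : V₂ → V₁` in a direct sum `V = V₁ ⊕ V₂` is coisotropic for
`(H₁, H₂^∨)` if and only if `L` intertwines the components of `H₁` and `H₂`. -/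
theorem coisotropic_graph_iff {V₁ V₂ : Type*} [AddCommGroup V₁] [Module ℂ V₁]
    [FiniteDimensional ℂ V₁] [AddCommGroup V₂] [Module ℂ V₂] [FiniteDimensional ℂ V₂]
    (H₁ : Wedge2A V₁) (H₂ : Wedge2A V₂) (L : V₂ →ₗ[ℂ] V₁)
    (p₁ : V →ₗ[ℂ] V₁) (i₁ : V₁ →ₗ[ℂ] V) (p₂ : V →ₗ[ℂ] V₂) (i₂ : V₂ →ₗ[ℂ] V) (G : V₂ →ₗ[ℂ] V)
    (h₁₁ : p₁ ∘ₗ i₁ = LinearMap.id) (h₁₂ : p₁ ∘ₗ i₂ = 0) (h₂₁ : p₂ ∘ₗ i₁ = 0)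
    (h₂₂ : p₂ ∘ₗ i₂ = LinearMap.id) (hG : G = i₁ ∘ₗ L + i₂) :
    (∀ u ∈ conormalK (LinearMap.range G), ∀ v ∈ conormalK (LinearMap.range G),
      (H₁.compLinearMap (mapAStar p₁ i₁) + (vee H₂).compLinearMap (mapAStar p₂ i₂)) ![u, v] = 0) ↔
    (piPart H₂).compLinearMap (map10 L).dualMap = piPart H₁ ∧
    (omegaPart H₁).compLinearMap (map01 L) = omegaPart H₂ ∧
    map10 L ∘ₗ thetaFlat H₂ = thetaFlat H₁ ∘ₗ map01 L := by
  have hp₁ : p₁ ∘ₗ G = L := by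
    rw [hG, LinearMap.comp_add, ← LinearMap.comp_assoc, h₁₁, h₁₂, add_zero, LinearMap.id_comp]
  have hp₂ : p₂ ∘ₗ G = LinearMap.id := by
    rw [hG, LinearMap.comp_add, ← LinearMap.comp_assoc, h₂₁, h₂₂, LinearMap.zero_comp, zero_add]
  -- The conormal space of the graph is parametrised freely by `v` and `ξ`: `of_mem` reads the
  -- parameters off an element, and `exists_mem` realises every choice.
  have key : (∀ u ∈ conormalK (LinearMap.range G), ∀ v ∈ conormalK (LinearMap.range G),
      (H₁.compLinearMap (mapAStar p₁ i₁) + (vee H₂).compLinearMap (mapAStar p₂ i₂)) ![u, v] = 0) ↔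
      ∀ (v w : T01 V₂) (ξ η : Module.Dual ℂ (T10 V₁)),
        H₁ ![(map01 L v, ξ), (map01 L w, η)] +
          vee H₂ ![(v, -(ξ ∘ₗ map10 L)), (w, -(η ∘ₗ map10 L))] = 0 := by
    have hd₁ : map10 p₁ ∘ₗ map10 i₁ = LinearMap.id := by rw [← map10_comp, h₁₁, map10_id]
    have hd₂ : map10 p₂ ∘ₗ map10 i₂ = LinearMap.id := by rw [← map10_comp, h₂₂, map10_id]
    have hd₁₂ : map10 p₁ ∘ₗ map10 i₂ = 0 := by rw [← map10_comp, h₁₂, map10_zero]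
    have hd₂₁ : map10 p₂ ∘ₗ map10 i₁ = 0 := by rw [← map10_comp, h₂₁, map10_zero]
    have hdG : map10 G = map10 i₁ ∘ₗ map10 L + map10 i₂ := by rw [hG, map10_add, map10_comp]
    have hv₁ : ∀ v, map01 p₁ (map01 G v) = map01 L v := fun v => by
      rw [← LinearMap.comp_apply, ← map01_comp, hp₁]
    have hv₂ : ∀ v, map01 p₂ (map01 G v) = v := fun v => by
      rw [← LinearMap.comp_apply, ← map01_comp, hp₂, map01_id, LinearMap.id_apply]
    have of_mem : ∀ u ∈ conormalK (LinearMap.range G), ∃ v ξ,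
        mapAStar p₁ i₁ u = (map01 L v, ξ) ∧ mapAStar p₂ i₂ u = (v, -(ξ ∘ₗ map10 L)) := by
      rintro ⟨a, ζ⟩ hu
      obtain ⟨⟨v, rfl⟩, hζ⟩ := (mem_conormalK_range_iff G p₂ hp₂ _).1 hu
      refine ⟨v, ζ ∘ₗ map10 i₁, Prod.ext (hv₁ v) rfl, Prod.ext (hv₂ v) ?_⟩
      change ζ ∘ₗ map10 i₂ = _
      rw [hdG, LinearMap.comp_add, ← LinearMap.comp_assoc, add_comm] at hζ
      exact eq_neg_of_add_eq_zero_left hζ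
    have exists_mem : ∀ v ξ, ∃ u ∈ conormalK (LinearMap.range G),
        mapAStar p₁ i₁ u = (map01 L v, ξ) ∧ mapAStar p₂ i₂ u = (v, -(ξ ∘ₗ map10 L)) := by
      -- The covector is forced: it must restrict to `ξ` on the first summand and to `-(ξ ∘ L)` on
      -- the second, which makes it vanish on the graph.
      intro v ξ
      have e₁ : (ξ ∘ₗ map10 p₁ - (ξ ∘ₗ map10 L) ∘ₗ map10 p₂) ∘ₗ map10 i₁ = ξ := by
        rw [LinearMap.sub_comp, LinearMap.comp_assoc, LinearMap.comp_assoc _ (map10 p₂), hd₁, hd₂₁,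
          LinearMap.comp_id, LinearMap.comp_zero, sub_zero]
      have e₂ : (ξ ∘ₗ map10 p₁ - (ξ ∘ₗ map10 L) ∘ₗ map10 p₂) ∘ₗ map10 i₂ = -(ξ ∘ₗ map10 L) := by
        rw [LinearMap.sub_comp, LinearMap.comp_assoc, LinearMap.comp_assoc _ (map10 p₂), hd₂, hd₁₂,
          LinearMap.comp_id, LinearMap.comp_zero, zero_sub]
      refine ⟨(map01 G v, ξ ∘ₗ map10 p₁ - (ξ ∘ₗ map10 L) ∘ₗ map10 p₂),
        (mem_conormalK_range_iff G p₂ hp₂ _).2 ⟨⟨v, rfl⟩, ?_⟩,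
        Prod.ext (hv₁ v) e₁, Prod.ext (hv₂ v) e₂⟩
      change (ξ ∘ₗ map10 p₁ - (ξ ∘ₗ map10 L) ∘ₗ map10 p₂) ∘ₗ map10 G = 0
      rw [hdG, LinearMap.comp_add, ← LinearMap.comp_assoc, e₁, e₂, add_neg_cancel]
    simp only [AlternatingMap.add_apply, compLinearMap_vecCons_pair]
    constructor
    · intro h v w ξ η
      obtain ⟨a, ha, ha₁, ha₂⟩ := exists_mem v ξ
      obtain ⟨b, hb, hb₁, hb₂⟩ := exists_mem w η
      simpa only [ha₁, ha₂, hb₁, hb₂] using h a ha b hb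
    · intro h a ha b hb
      obtain ⟨v, ξ, ha₁, ha₂⟩ := of_mem a ha
      obtain ⟨w, η, hb₁, hb₂⟩ := of_mem b hb
      simpa only [ha₁, ha₂, hb₁, hb₂] using h v w ξ η
  have neg_snd : ∀ ξ : Module.Dual ℂ (T10 V₂), ((0, -ξ) : AStar V₂) = -(0, ξ) := fun ξ => by simp
  rw [key, map_thetaFlat_eq_iff]
  simp only [apply_eq_components H₁, vee_apply, neg_snd, map_neg, LinearMap.neg_apply, neg_neg]
  constructor
  · intro h
    -- Taking `v = w = 0` leaves only the `π` terms, `ξ = η = 0` only the `ω` terms, and `w = 0`, `ξ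
    -- = 0` only one pair of `θ` terms.
    refine ⟨alternating_ext_pair fun ξ η => ?_, alternating_ext_pair fun v w => ?_, fun v ξ => ?_⟩
    · rw [compLinearMap_vecCons_pair, piPart_apply, piPart_apply]
      have := h 0 0 ξ η
      simp only [map_zero, ← Prod.zero_eq_mk, LinearMap.zero_apply] at this
      change pairing H₂ (0, ξ ∘ₗ map10 L) (0, η ∘ₗ map10 L) = _
      linear_combination -this
    · rw [compLinearMap_vecCons_pair, omegaPart_apply, omegaPart_apply]
      have := h v w 0 0
      simp only [map_zero, LinearMap.zero_comp, ← Prod.zero_eq_mk] at this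
      linear_combination this
    · have := h v 0 0 ξ
      simp only [map_zero, LinearMap.zero_comp, ← Prod.zero_eq_mk] at this
      linear_combination this
  · rintro ⟨hπ, hω, hθ⟩ v w ξ η
    have eπ := congrArg (fun K => K ![ξ, η]) hπ
    have eω := congrArg (fun K => K ![v, w]) hω
    simp only [compLinearMap_vecCons_pair, piPart_apply, omegaPart_apply] at eπ eω
    change pairing H₂ (0, ξ ∘ₗ map10 L) (0, η ∘ₗ map10 L) = _ at eπ
    -- The mixed identity enters twice, because `θ` contributes once for each order of the two
    -- arguments.
    linear_combination eω - eπ + hθ v η - hθ w ξ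

end LinearAlgebra

end ExtPoisson

namespace ExtPoisson

/-! ### Graphs of holomorphic maps: submanifold structure, tangent spaces, coisotropy. -/

section Graph

variable {E₁ : Type*} [NormedAddCommGroup E₁] [NormedSpace ℂ E₁]
  {X₁ : Type*} [TopologicalSpace X₁] [ChartedSpace E₁ X₁]
  {E₂ : Type*} [NormedAddCommGroup E₂] [NormedSpace ℂ E₂]
  {X₂ : Type*} [TopologicalSpace X₂] [ChartedSpace E₂ X₂]

/-- In a chart `φ` of the target, the graph is the zero set of `φ(a) - φ(f x)`. Its differential is
surjective already along the first factor, where it is the invertible differential of `φ`. -/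
theorem isComplexSubmanifold_graph [FiniteDimensional ℂ E₁] [T2Space X₁]
    [IsManifold 𝓘(ℂ, E₁) ω X₁] {f : X₂ → X₁} (hf : ContMDiff 𝓘(ℂ, E₂) 𝓘(ℂ, E₁) ω f) :
    IsComplexSubmanifold (𝓘(ℂ, E₁).prod 𝓘(ℂ, E₂)) (Set.range fun x => (f x, x)) := by
  have hgraph : ∀ p : X₁ × X₂, p ∈ Set.range (fun x => (f x, x)) ↔ p.1 = f p.2 := by
    rintro ⟨a, x⟩
    constructor
    · rintro ⟨y, hy⟩
      cases hy
      rfl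
    · intro h
      exact ⟨x, Prod.ext h.symm rfl⟩
  constructor
  · have : (Set.range fun x => (f x, x)) = {p : X₁ × X₂ | p.1 = f p.2} := Set.ext hgraph
    rw [this]
    exact isClosed_eq continuous_fst (hf.continuous.comp continuous_snd)
  · rintro _ ⟨x₀, rfl⟩
    set φ := extChartAt 𝓘(ℂ, E₁) (f x₀) with hφ
    -- Local equations must take values in some `ℂ^m`, so the model space is identified with
    -- coordinates.
    let e : E₁ ≃L[ℂ] (Fin (Module.finrank ℂ E₁) → ℂ) :=
      ContinuousLinearEquiv.ofFinrankEq (by simp)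
    have hsrc : IsOpen φ.source := isOpen_extChartAt_source _
    have hφs : ContMDiffOn 𝓘(ℂ, E₁) 𝓘(ℂ, E₁) ω φ φ.source := by
      rw [hφ, extChartAt_source]
      exact contMDiffOn_extChartAt
    have he : ContMDiff 𝓘(ℂ, E₁) 𝓘(ℂ, Fin (Module.finrank ℂ E₁) → ℂ) ω e :=
      e.contDiff.contMDiff
    have hF : ContMDiffOn (𝓘(ℂ, E₁).prod 𝓘(ℂ, E₂)) 𝓘(ℂ, Fin (Module.finrank ℂ E₁) → ℂ) ω
        (fun p : X₁ × X₂ => e (φ p.1) - e (φ (f p.2))) (φ.source ×ˢ (f ⁻¹' φ.source)) :=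
      ((he.comp_contMDiffOn hφs).comp contMDiff_fst.contMDiffOn fun p hp => hp.1).sub
        ((he.comp_contMDiffOn hφs).comp (hf.comp contMDiff_snd).contMDiffOn fun p hp => hp.2)
    have hU : IsOpen (φ.source ×ˢ (f ⁻¹' φ.source)) := hsrc.prod (hsrc.preimage hf.continuous)
    refine ⟨_, hU, ⟨mem_extChartAt_source _, mem_extChartAt_source _⟩, _, _, hF, ?_, ?_⟩
    · intro p hp
      rw [hgraph, sub_eq_zero, e.injective.eq_iff]
      exact (φ.injOn.eq_iff hp.1 hp.2).symm
    · rintro ⟨a, x⟩ hp -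
      have hFp := (hF.contMDiffAt (hU.mem_nhds hp)).mdifferentiableAt (by simp)
      have hι : MDifferentiableAt 𝓘(ℂ, E₁) (𝓘(ℂ, E₁).prod 𝓘(ℂ, E₂)) (fun y : X₁ => (y, x)) a :=
        mdifferentiableAt_id.prodMk mdifferentiableAt_const
      have hcomp := mfderiv_comp a hFp hι
      have hK : HasMFDerivAt 𝓘(ℂ, E₁) 𝓘(ℂ, Fin (Module.finrank ℂ E₁) → ℂ)
          (fun y => e y - e (φ (f x))) (φ a) e.toContinuousLinearMap :=
        (e.hasFDerivAt.sub_const _).hasMFDerivAt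
      have hφa : MDifferentiableAt 𝓘(ℂ, E₁) 𝓘(ℂ, E₁) φ a :=
        (hφs.contMDiffAt (hsrc.mem_nhds hp.1)).mdifferentiableAt (by simp)
      have hcomp' := mfderiv_comp a hK.mdifferentiableAt hφa
      rw [hK.mfderiv] at hcomp'
      have hinv : (mfderiv 𝓘(ℂ, E₁) 𝓘(ℂ, E₁) φ a).IsInvertible :=
        isInvertible_mfderiv_extChartAt hp.1
      intro w
      obtain ⟨v, hv⟩ := hinv.bijective.surjective (e.symm w)
      refine ⟨mfderiv 𝓘(ℂ, E₁) (𝓘(ℂ, E₁).prod 𝓘(ℂ, E₂)) (fun y : X₁ => (y, x)) a v, ?_⟩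
      refine (DFunLike.congr_fun (hcomp.symm.trans hcomp') v).trans ?_
      exact (congrArg e hv).trans (e.apply_symm_apply w)

/-- The disc is the affine line in the chart at `x` with direction `dφ(v)`, carried back by the
inverse chart. It provides the velocities needed to fill the tangent space of a graph. -/
theorem exists_holomorphic_disc [IsManifold 𝓘(ℂ, E₂) ω X₂] (x : X₂)
    (v : TangentSpace 𝓘(ℂ, E₂) x) :
    ∃ c : ℂ → X₂, ContMDiffAt 𝓘(ℂ, ℂ) 𝓘(ℂ, E₂) ω c 0 ∧ c 0 = x ∧
      (mfderiv 𝓘(ℂ, ℂ) 𝓘(ℂ, E₂) c 0 (1 : ℂ) : E₂) = v := by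
  set φ := extChartAt 𝓘(ℂ, E₂) x with hφ
  let w : E₂ := mfderiv 𝓘(ℂ, E₂) 𝓘(ℂ, E₂) φ x v
  have hl0 : φ x + (0 : ℂ) • w = φ x := by simp
  have hl : HasFDerivAt (fun t : ℂ => φ x + t • w) (ContinuousLinearMap.toSpanSingleton ℂ w) 0 :=
    ((ContinuousLinearMap.toSpanSingleton ℂ w).hasFDerivAt (x := 0)).const_add (φ x)
  have hls : ContDiff ℂ ω (fun t : ℂ => φ x + t • w) := by fun_prop
  have hmem : φ.target ∈ nhds (φ x) := extChartAt_target_mem_nhds x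
  have hφs : ContMDiffAt 𝓘(ℂ, E₂) 𝓘(ℂ, E₂) ω φ.symm (φ x) :=
    (contMDiffOn_extChartAt_symm x).contMDiffAt hmem
  have hφs' : ContMDiffAt 𝓘(ℂ, E₂) 𝓘(ℂ, E₂) ω φ.symm (φ x + (0 : ℂ) • w) := by rwa [hl0]
  refine ⟨fun t => φ.symm (φ x + t • w), hφs'.comp 0 hls.contMDiff.contMDiffAt, ?_, ?_⟩
  · exact (congrArg φ.symm hl0).trans (extChartAt_to_inv x)
  · have h1 := mfderiv_comp_apply_of_eq (I := 𝓘(ℂ, ℂ)) 0 (hφs.mdifferentiableAt (by simp))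
      hl.hasMFDerivAt.mdifferentiableAt hl0 (1 : ℂ)
    rw [hl.hasMFDerivAt.mfderiv] at h1
    have h2 := mfderivWithin_extChartAt_symm_comp_mfderiv_extChartAt' (I := 𝓘(ℂ, E₂))
      (mem_extChartAt_source (I := 𝓘(ℂ, E₂)) x)
    simp only [modelWithCornersSelf_coe, Set.range_id, mfderivWithin_univ] at h2
    refine h1.trans (Eq.trans ?_ (DFunLike.congr_fun h2 v))
    exact congrArg (mfderiv 𝓘(ℂ, E₂) 𝓘(ℂ, E₂) φ.symm (φ x)) (one_smul ℂ w)

/-- A disc lying in the graph is the image under `x ↦ (f x, x)` of its second component, so its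
velocity is in the range by the chain rule. Conversely, every tangent vector of `X₂` is the velocity
of a disc, which this map sends into the graph. -/
theorem tangentAt_graph [IsManifold 𝓘(ℂ, E₂) ω X₂] {f : X₂ → X₁}
    (hf : ContMDiff 𝓘(ℂ, E₂) 𝓘(ℂ, E₁) ω f) (x : X₂) :
    tangentAt (𝓘(ℂ, E₁).prod 𝓘(ℂ, E₂)) (Set.range fun x => (f x, x)) (f x, x) =
      LinearMap.range (mfderiv 𝓘(ℂ, E₂) (𝓘(ℂ, E₁).prod 𝓘(ℂ, E₂)) (fun x => (f x, x)) x).toLinearMap := by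
  have hG : ContMDiff 𝓘(ℂ, E₂) (𝓘(ℂ, E₁).prod 𝓘(ℂ, E₂)) ω (fun x => (f x, x)) :=
    hf.prodMk contMDiff_id
  apply le_antisymm
  · refine Submodule.span_le.2 ?_
    rintro v ⟨γ, hγ, hmem, hv⟩
    have hγ₂ : ContMDiffAt 𝓘(ℂ, ℂ) 𝓘(ℂ, E₂) ω (fun t => (γ t).2) 0 := hγ.snd
    have hγeq : γ =ᶠ[nhds 0] (fun x => (f x, x)) ∘ fun t => (γ t).2 := by
      filter_upwards [hmem] with t ht
      obtain ⟨y, hy⟩ := ht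
      simp only [Function.comp_apply, ← hy]
    have hx : (γ 0).2 = x :=
      congrArg (fun p : TangentBundle (𝓘(ℂ, E₁).prod 𝓘(ℂ, E₂)) (X₁ × X₂) => p.1.2) hv
    have hv' : (mfderiv 𝓘(ℂ, ℂ) (𝓘(ℂ, E₁).prod 𝓘(ℂ, E₂)) γ 0 (1 : ℂ) : E₁ × E₂) = v :=
      congrArg (fun p : TangentBundle (𝓘(ℂ, E₁).prod 𝓘(ℂ, E₂)) (X₁ × X₂) => (p.2 : E₁ × E₂)) hv
    refine ⟨mfderiv 𝓘(ℂ, ℂ) 𝓘(ℂ, E₂) (fun t => (γ t).2) 0 (1 : ℂ), Eq.trans ?_ hv'⟩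
    have hd : (mfderiv 𝓘(ℂ, ℂ) (𝓘(ℂ, E₁).prod 𝓘(ℂ, E₂)) γ 0 : ℂ →L[ℂ] E₁ × E₂) =
        mfderiv 𝓘(ℂ, ℂ) (𝓘(ℂ, E₁).prod 𝓘(ℂ, E₂)) ((fun x => (f x, x)) ∘ fun t => (γ t).2) 0 :=
      hγeq.mfderiv_eq
    -- The base point `(γ 0).2` equals `x` only through `hx`, hence the form of the chain rule with
    -- an equation for the base point.
    have hc := mfderiv_comp_apply_of_eq (I := 𝓘(ℂ, ℂ)) 0 (hG.mdifferentiableAt (by simp))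
      (hγ₂.mdifferentiableAt (by simp)) hx (1 : ℂ)
    exact hc.symm.trans (DFunLike.congr_fun hd (1 : ℂ)).symm
  · rintro _ ⟨v, rfl⟩
    obtain ⟨c, hc, hc0, hcv⟩ := exists_holomorphic_disc x v
    refine Submodule.subset_span ⟨fun t => (f (c t), c t), ?_, .of_forall fun t => ⟨c t, rfl⟩, ?_⟩
    · exact (hG.contMDiffAt (x := c 0)).comp 0 hc
    · have hcomp := mfderiv_comp_apply_of_eq (I := 𝓘(ℂ, ℂ)) 0 (hG.mdifferentiableAt (by simp))
        (hc.mdifferentiableAt (by simp)) hc0 (1 : ℂ)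
      refine Bundle.TotalSpace.ext (congrArg (fun y => (f y, y)) hc0) (heq_of_eq ?_)
      exact hcomp.trans (congrArg _ hcv)

theorem isPoissonRelation_graph_iff [FiniteDimensional ℂ E₁] [T2Space X₁]
    [IsManifold 𝓘(ℂ, E₁) ω X₁] [FiniteDimensional ℂ E₂] [IsManifold 𝓘(ℂ, E₂) ω X₂]
    (H₁ : Field2 𝓘(ℂ, E₁) X₁) (H₂ : Field2 𝓘(ℂ, E₂) X₂) {f : X₂ → X₁}
    (hf : ContMDiff 𝓘(ℂ, E₂) 𝓘(ℂ, E₁) ω f) :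
    IsPoissonRelation H₁ H₂ (Set.range fun x => (f x, x)) ↔ ∀ x : X₂,
      (piPart (H₂ x)).compLinearMap (push10 𝓘(ℂ, E₁) 𝓘(ℂ, E₂) f x).dualMap = piPart (H₁ (f x)) ∧
      (omegaPart (H₁ (f x))).compLinearMap (push01 𝓘(ℂ, E₁) 𝓘(ℂ, E₂) f x) = omegaPart (H₂ x) ∧
      push10 𝓘(ℂ, E₁) 𝓘(ℂ, E₂) f x ∘ₗ thetaFlat (H₂ x) =
        thetaFlat (H₁ (f x)) ∘ₗ push01 𝓘(ℂ, E₁) 𝓘(ℂ, E₂) f x := by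
  rw [IsPoissonRelation, IsCoisotropic, and_iff_right (isComplexSubmanifold_graph hf),
    Set.forall_mem_range]
  refine forall_congr' fun x => ?_
  have hf' : MDifferentiableAt 𝓘(ℂ, E₂) 𝓘(ℂ, E₁) f x := hf.mdifferentiableAt (by simp)
  have hG : mfderiv 𝓘(ℂ, E₂) (𝓘(ℂ, E₁).prod 𝓘(ℂ, E₂)) (fun x => (f x, x)) x =
      (mfderiv 𝓘(ℂ, E₂) 𝓘(ℂ, E₁) f x).prod (ContinuousLinearMap.id ℂ (TangentSpace 𝓘(ℂ, E₂) x)) :=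
    (mfderiv_prodMk hf' mdifferentiableAt_id).trans (by rw [mfderiv_id])
  rw [tangentAt_graph hf x]
  -- The differentials of the two projections and of the two slice inclusions through the point
  -- supply the direct sum decomposition.
  refine coisotropic_graph_iff (H₁ (f x)) (H₂ x) (mfderiv 𝓘(ℂ, E₂) 𝓘(ℂ, E₁) f x).toLinearMap
    _ _ _ _ _ ?_ ?_ ?_ ?_ ?_
  · rw [mfderiv_fst, mfderiv_prod_left]
    rfl
  · rw [mfderiv_fst, mfderiv_prod_right]
    rfl
  · rw [mfderiv_snd, mfderiv_prod_left]
    rfl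
  · rw [mfderiv_snd, mfderiv_prod_right]
    rfl
  · rw [mfderiv_prod_left, mfderiv_prod_right, hG]
    refine LinearMap.ext fun v => Prod.ext ?_ ?_
    · exact (add_zero (mfderiv 𝓘(ℂ, E₂) 𝓘(ℂ, E₁) f x v : E₁)).symm
    · exact (zero_add (v : E₂)).symm

end Graph

end ExtPoisson

/-! ### The proposition and its corollary on composition. -/

theorem mainTheorem6
    {E₁ : Type*} [NormedAddCommGroup E₁] [NormedSpace ℂ E₁] [FiniteDimensional ℂ E₁]
    {X₁ : Type*} [TopologicalSpace X₁] [T2Space X₁] [ChartedSpace E₁ X₁]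
    [IsManifold 𝓘(ℂ, E₁) ω X₁]
    {E₂ : Type*} [NormedAddCommGroup E₂] [NormedSpace ℂ E₂] [FiniteDimensional ℂ E₂]
    {X₂ : Type*} [TopologicalSpace X₂] [T2Space X₂] [ChartedSpace E₂ X₂]
    [IsManifold 𝓘(ℂ, E₂) ω X₂]
    {E₃ : Type*} [NormedAddCommGroup E₃] [NormedSpace ℂ E₃] [FiniteDimensional ℂ E₃]
    {X₃ : Type*} [TopologicalSpace X₃] [T2Space X₃] [ChartedSpace E₃ X₃]
    [IsManifold 𝓘(ℂ, E₃) ω X₃]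
    (H₁ : ExtPoisson.Field2 𝓘(ℂ, E₁) X₁) (hH₁ : ExtPoisson.IsExtendedPoisson H₁)
    (H₂ : ExtPoisson.Field2 𝓘(ℂ, E₂) X₂) (hH₂ : ExtPoisson.IsExtendedPoisson H₂)
    (H₃ : ExtPoisson.Field2 𝓘(ℂ, E₃) X₃) (hH₃ : ExtPoisson.IsExtendedPoisson H₃) :
    (∀ f : X₂ → X₁, ContMDiff 𝓘(ℂ, E₂) 𝓘(ℂ, E₁) ω f →
      (ExtPoisson.IsExtendedPoissonMap H₁ H₂ f ↔
        (∀ x : X₂, (ExtPoisson.piPart (H₂ x)).compLinearMap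
            (ExtPoisson.push10 𝓘(ℂ, E₁) 𝓘(ℂ, E₂) f x).dualMap = ExtPoisson.piPart (H₁ (f x))) ∧
        (∀ x : X₂, (ExtPoisson.omegaPart (H₁ (f x))).compLinearMap
            (ExtPoisson.push01 𝓘(ℂ, E₁) 𝓘(ℂ, E₂) f x) = ExtPoisson.omegaPart (H₂ x)) ∧
        (∀ x : X₂, ExtPoisson.push10 𝓘(ℂ, E₁) 𝓘(ℂ, E₂) f x ∘ₗ ExtPoisson.thetaFlat (H₂ x) =
            ExtPoisson.thetaFlat (H₁ (f x)) ∘ₗ ExtPoisson.push01 𝓘(ℂ, E₁) 𝓘(ℂ, E₂) f x))) ∧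
    (∀ (f : X₂ → X₁) (g : X₃ → X₂), ExtPoisson.IsExtendedPoissonMap H₁ H₂ f →
      ExtPoisson.IsExtendedPoissonMap H₂ H₃ g → ExtPoisson.IsExtendedPoissonMap H₁ H₃ (f ∘ g)) := by
  have graph_iff : ∀ f : X₂ → X₁, ContMDiff 𝓘(ℂ, E₂) 𝓘(ℂ, E₁) ω f → _ := fun f hf =>
    ExtPoisson.isPoissonRelation_graph_iff H₁ H₂ hf
  refine ⟨fun f hf => ?_, ?_⟩
  · rw [ExtPoisson.IsExtendedPoissonMap, and_iff_right hf, graph_iff f hf, forall_and, forall_and]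
  · rintro f g ⟨hf, hfR⟩ ⟨hg, hgR⟩
    refine ⟨hf.comp hg, (ExtPoisson.isPoissonRelation_graph_iff H₁ H₃ (hf.comp hg)).2 fun x => ?_⟩
    obtain ⟨fπ, fω, fθ⟩ := (graph_iff f hf).1 hfR (g x)
    obtain ⟨gπ, gω, gθ⟩ := (ExtPoisson.isPoissonRelation_graph_iff H₂ H₃ hg).1 hgR x
    have hd : mfderiv 𝓘(ℂ, E₃) 𝓘(ℂ, E₁) (f ∘ g) x =
        (mfderiv 𝓘(ℂ, E₂) 𝓘(ℂ, E₁) f (g x)).comp (mfderiv 𝓘(ℂ, E₃) 𝓘(ℂ, E₂) g x) :=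
      mfderiv_comp x (hf.mdifferentiableAt (by simp)) (hg.mdifferentiableAt (by simp))
    have h10 : ExtPoisson.push10 𝓘(ℂ, E₁) 𝓘(ℂ, E₃) (f ∘ g) x =
        ExtPoisson.push10 𝓘(ℂ, E₁) 𝓘(ℂ, E₂) f (g x) ∘ₗ
          ExtPoisson.push10 𝓘(ℂ, E₂) 𝓘(ℂ, E₃) g x := by
      rw [ExtPoisson.push10, hd]
      exact ExtPoisson.map10_comp _ _
    have h01 : ExtPoisson.push01 𝓘(ℂ, E₁) 𝓘(ℂ, E₃) (f ∘ g) x =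
        ExtPoisson.push01 𝓘(ℂ, E₁) 𝓘(ℂ, E₂) f (g x) ∘ₗ
          ExtPoisson.push01 𝓘(ℂ, E₂) 𝓘(ℂ, E₃) g x := by
      rw [ExtPoisson.push01, hd]
      exact ExtPoisson.map01_comp _ _
    rw [h10, h01]
    refine ⟨?_, ?_, ?_⟩
    -- Bivectors push forward first along `g`, then along `f`. The forms `ω` below pull back in the
    -- opposite order.
    · refine Eq.trans ?_ fπ
      rw [← gπ]
      rfl
    · refine Eq.trans ?_ gω
      rw [← fω]
      rfl
    · rw [LinearMap.comp_assoc, gθ, ← LinearMap.comp_assoc, fθ]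
      rfl
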